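/- Let $d\ge 2$, let $\Omega\subset\mathbb R^d$ be a nonempty bounded open set (in particular, a bounded domain with Lipschitz boundary), and write $x,y$ for the first two coordinates of $\mathbf x\in\mathbb R^d$. Let $V_1,V_2:\Omega\to\mathbb R$, $\omega_1,\omega_2,\beta\in\mathbb R$ and a real matrix $K=(k_{ij})_{1\le i,j\le2}$ satisfy: - (A1) $V_i\in L^\infty(\Omega)$ for $i=1,2$, and for some constant $\alpha>0$, $V_i(\mathbf x)\ge\frac{1+\alpha}{2}\omega_i^2(x^2+y^2)+|\beta|$ for almost all $\mathbf x\in\Omega$, $i=1,2$; - (A2) $K$ is symmetric, and either $K$ is positive definite or all its entries are non-negative. Let $H^1_0(\Omega)$ be the closure of $C_c^\infty(\Omega;\mathbb C)$ in the $H^1$ norm. For $\Psi=(\psi_1,\psi_2)\in[H^1_0(\Omega)]^2$ put $\|\Psi\|_{L^2}^2=\|\psi_1\|_{L^2(\Omega)}^2+\|\psi_2\|_{L^2(\Omega)}^2$, $\rho_i(\Psi)=k_{i1}|\psi_1|^2+k_{i2}|\psi_2|^2$, $L_z=-\mathrm i(x\partial_y-y\partial_x)$ and $$E(\Psi)=\sum_{i=1}^{2}\int_\Omega\Big(\tfrac12|\nabla\psi_i|^2+V_i|\psi_i|^2+\tfrac12\rho_i(\Psi)|\psi_i|^2-\omega_i\,\mathrm{Re}\big(\overline{\psi_i}\,L_z\psi_i\big)\Big)\,\mathrm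 d\mathbf x+2\beta\int_\Omega\mathrm{Re}(\psi_1\overline{\psi_2})\,\mathrm d\mathbf x .$$ Let $\mathcal M=\{\Psi\in[H^1_0(\Omega)]^2 : \|\Psi\|_{L^2}=1,\ E(\Psi)<\infty\}$, where $E(\Psi)<\infty$ means that the integrands above are integrable over $\Omega$. Then there exists $\Psi_g\in\mathcal M$ with $E(\Psi_g)\le E(\Phi)$ for all $\Phi\in\mathcal M$. -/

import Mathlib

open MeasureTheory

noncomputable section

namespace TwoComponentBEC

/-- The Euclidean space `ℝ^d`. -/
abbrev Space (d : ℕ) : Type := EuclideanSpace ℝ (Fin d)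

variable {d : ℕ}

/-- The first coordinate direction `x` of `ℝ^d`, `d ≥ 2`. -/
def xDir (hd : 2 ≤ d) : Fin d := ⟨0, by omega⟩

/-- The second coordinate direction `y` of `ℝ^d`, `d ≥ 2`. -/
def yDir (hd : 2 ≤ d) : Fin d := ⟨1, by omega⟩

/-! ### The Sobolev space `H¹₀(Ω)` of complex-valued functions -/

/-- `φ ∈ C_c^∞(Ω; ℂ)`: smooth with compact support contained in `Ω`. -/
structure IsTestFunction (Ω : Set (Space d)) (φ : Space d → ℂ) : Prop where
  smooth : ContDiff ℝ (⊤ : ℕ∞) φ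
  compact : HasCompactSupport φ
  support : tsupport φ ⊆ Ω

/-- The classical gradient `(∂₁φ, …, ∂_dφ)` of a complex-valued function. -/
def classicalGrad (φ : Space d → ℂ) (x : Space d) : EuclideanSpace ℂ (Fin d) :=
  WithLp.toLp 2 fun j => fderiv ℝ φ x (EuclideanSpace.single j 1)

/-- The Hilbert space `L²(Ω; ℂ)`. -/
abbrev L2 (Ω : Set (Space d)) : Type := Lp ℂ 2 (volume.restrict Ω)

/-- The Hilbert space `L²(Ω; ℂ^d)`. -/
abbrev L2Vec (Ω : Set (Space d)) : Type :=
  Lp (EuclideanSpace ℂ (Fin d)) 2 (volume.restrict Ω)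

/-- The Hilbert space `L²(Ω; ℂ) × L²(Ω; ℂ^d)`, whose norm restricts to the `H¹` norm
`(‖u‖² + ‖∇u‖²)^{1/2}` on pairs `(u, ∇u)`. -/
abbrev L2Pair (Ω : Set (Space d)) : Type := WithLp 2 (L2 Ω × L2Vec Ω)

/-- The space of pairs `(φ, ∇φ)` with `φ ∈ C_c^∞(Ω; ℂ)`. -/
def testPairs (Ω : Set (Space d)) : Submodule ℂ (L2Pair Ω) where
  carrier := {p | ∃ φ : Space d → ℂ, IsTestFunction Ω φ ∧
    p.fst =ᵐ[volume.restrict Ω] φ ∧ p.snd =ᵐ[volume.restrict Ω] classicalGrad φ}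
  zero_mem' := by
    refine ⟨0, ⟨contDiff_const, HasCompactSupport.zero, by simp [tsupport]⟩, ?_, ?_⟩
    · exact Lp.coeFn_zero _ _ _
    · refine (Lp.coeFn_zero _ _ _).trans (Filter.Eventually.of_forall fun x => ?_)
      ext j
      simp [classicalGrad]
  add_mem' := by
    rintro p q ⟨φ, hφ, hp, hp'⟩ ⟨η, hη, hq, hq'⟩
    refine ⟨φ + η, ⟨hφ.smooth.add hη.smooth, hφ.compact.add hη.compact,
      (tsupport_add φ η).trans (Set.union_subset hφ.support hη.support)⟩, ?_, ?_⟩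
    · exact (Lp.coeFn_add p.fst q.fst).trans (hp.add hq)
    · refine (Lp.coeFn_add p.snd q.snd).trans ((hp'.add hq').trans
        (Filter.Eventually.of_forall fun x => ?_))
      ext j
      simp [classicalGrad, fderiv_add (hφ.smooth.differentiable (by simp) x)
        (hη.smooth.differentiable (by simp) x)]
  smul_mem' := by
    rintro c p ⟨φ, hφ, hp, hp'⟩
    refine ⟨c • φ, ⟨contDiff_const.smul hφ.smooth, hφ.compact.smul_left,
      (closure_mono (Function.support_const_smul_subset c φ)).trans hφ.support⟩, ?_, ?_⟩
    · exact (Lp.coeFn_smul c p.fst).trans (hp.const_smul c)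
    · refine (Lp.coeFn_smul c p.snd).trans ((hp'.const_smul c).trans
        (Filter.Eventually.of_forall fun x => ?_))
      ext j
      simp [classicalGrad, fderiv_const_smul (hφ.smooth.differentiable (by simp) x)]

/-- The complex Sobolev space `H¹₀(Ω)`: the closure of `C_c^∞(Ω; ℂ)` in the `H¹` norm. An element
is the pair of a function `u` in `L²(Ω; ℂ)` and its weak gradient in `L²(Ω; ℂ^d)`; see
`integral_fderiv_smul_fn` and `ext_fn`. -/
def H10 (Ω : Set (Space d)) : Submodule ℂ (L2Pair Ω) := (testPairs Ω).topologicalClosure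

/-- The underlying `L²` function of an element of `H¹₀(Ω)`. -/
def fn {Ω : Set (Space d)} (u : H10 Ω) : L2 Ω := (u : L2Pair Ω).fst

/-- The weak gradient of an element of `H¹₀(Ω)`. -/
def wgrad {Ω : Set (Space d)} (u : H10 Ω) : L2Vec Ω := (u : L2Pair Ω).snd

/-- `wgrad u` is the weak gradient of `fn u` on `Ω`:
`∫_Ω u ∂_jη = - ∫_Ω (∇u)_j η` for all `η ∈ C_c^∞(Ω; ℝ)`. -/
theorem integral_fderiv_smul_fn {Ω : Set (Space d)} (u : H10 Ω) (η : Space d → ℝ)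
    (hη : ContDiff ℝ (⊤ : ℕ∞) η) (hc : HasCompactSupport η) (hs : tsupport η ⊆ Ω) (j : Fin d) :
    ∫ x in Ω, fderiv ℝ η x (EuclideanSpace.single j 1) • fn u x
      = - ∫ x in Ω, η x • wgrad u x j := by
  have hD : ContDiff ℝ (⊤ : ℕ∞) fun x => fderiv ℝ η x (EuclideanSpace.single j 1) :=
    (hη.fderiv_right (by simp)).clm_apply contDiff_const
  have hDc : HasCompactSupport fun x => fderiv ℝ η x (EuclideanSpace.single j 1) :=
    hc.fderiv_apply ℝ _
  have hA : MemLp (fun x => ((fderiv ℝ η x (EuclideanSpace.single j 1) : ℝ) : ℂ)) 2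
      (volume.restrict Ω) :=
    ((Complex.continuous_ofReal.comp hD.continuous).memLp_of_hasCompactSupport
      (hDc.comp_left (g := fun r : ℝ => (r : ℂ)) Complex.ofReal_zero)).restrict Ω
  have hB : MemLp (fun x => EuclideanSpace.single j ((η x : ℝ) : ℂ)) 2 (volume.restrict Ω) :=
    MemLp.restrict Ω (Continuous.memLp_of_hasCompactSupport 
      ((PiLp.continuous_toLp 2 _).comp ((continuous_single j).comp
        (Complex.continuous_ofReal.comp hη.continuous))) (hc.comp_left (g := fun r : ℝ => EuclideanSpace.single j (r : ℂ)) (by simp)))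
  have e1 : ∀ f : L2 Ω, ∫ x in Ω, fderiv ℝ η x (EuclideanSpace.single j 1) • f x
      = inner ℂ (hA.toLp _) f := by
    intro f
    rw [L2.inner_def]
    refine integral_congr_ae (hA.coeFn_toLp.mono fun x hx => ?_)
    simp only [hx]
    simp [mul_comm]
  have e2 : ∀ g : L2Vec Ω, ∫ x in Ω, η x • g x j = inner ℂ (hB.toLp _) g := by
    intro g
    rw [L2.inner_def]
    refine integral_congr_ae (hB.coeFn_toLp.mono fun x hx => ?_)
    simp only [hx]
    simp [EuclideanSpace.inner_single_left]
  have key : closure (testPairs Ω : Set (L2Pair Ω)) ⊆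
      {p | inner ℂ (hA.toLp _) p.fst = - inner ℂ (hB.toLp _) p.snd} := by
    refine closure_minimal ?_ (isClosed_eq ?_ ?_)
    · rintro p ⟨φ, hφ, h1, h2⟩
      have hφd : Differentiable ℝ φ := hφ.smooth.differentiable (by simp)
      have hηd : Differentiable ℝ η := hη.differentiable (by simp)
      have hφD : Continuous fun x => fderiv ℝ φ x (EuclideanSpace.single j 1) :=
        (hφ.smooth.continuous_fderiv (by simp)).clm_apply continuous_const
      rw [Set.mem_ofPred_eq, ← e1, ← e2]
      have i1 : ∫ x in Ω, fderiv ℝ η x (EuclideanSpace.single j 1) • p.fst x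
          = ∫ x, fderiv ℝ η x (EuclideanSpace.single j 1) • φ x := by
        rw [← setIntegral_eq_integral_of_forall_compl_eq_zero (s := Ω)
          (f := fun x => fderiv ℝ η x (EuclideanSpace.single j 1) • φ x)]
        · exact integral_congr_ae (h1.mono fun x hx => by simp only [hx])
        · intro x hx
          rw [image_eq_zero_of_notMem_tsupport (fun h => hx (hφ.support h)), smul_zero]
      have i2 : ∫ x in Ω, η x • p.snd x j
          = ∫ x, η x • fderiv ℝ φ x (EuclideanSpace.single j 1) := by
        rw [← setIntegral_eq_integral_of_forall_compl_eq_zero (s := Ω)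
          (f := fun x => η x • fderiv ℝ φ x (EuclideanSpace.single j 1))]
        · exact integral_congr_ae (h2.mono fun x hx => by simp only [hx, classicalGrad])
        · intro x hx
          rw [image_eq_zero_of_notMem_tsupport (fun h => hx (hs h)), zero_smul]
      rw [i1, i2, integral_smul_fderiv_eq_neg_fderiv_smul_of_integrable, neg_neg]
      · exact (hD.continuous.smul hφ.smooth.continuous).integrable_of_hasCompactSupport
          hDc.smul_right
      · exact (hη.continuous.smul hφD).integrable_of_hasCompactSupport hc.smul_right
      · exact (hη.continuous.smul hφ.smooth.continuous).integrable_of_hasCompactSupport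
          hc.smul_right
      · exact fun x _ => hηd x
      · exact fun x _ => hφd x
    · fun_prop
    · fun_prop
  rw [e1, e2]
  exact key u.2

/-- The weak gradient is determined by the function, so `H¹₀(Ω)` is a space of functions. -/
theorem ext_fn {Ω : Set (Space d)} (hΩ : IsOpen Ω) {u v : H10 Ω} (h : fn u = fn v) :
    u = v := by
  have hg : wgrad u = wgrad v := by
    have hj : ∀ j : Fin d, ∀ᵐ x ∂(volume.restrict Ω), wgrad u x j - wgrad v x j = 0 := by
      intro j
      have hl : ∀ w : L2Vec Ω, LocallyIntegrable (fun x => w x j) (volume.restrict Ω) := fun w =>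
        ((EuclideanSpace.proj (𝕜 := ℂ) j).comp_memLp w).locallyIntegrable (by norm_num)
      have := hΩ.ae_eq_zero_of_integral_contDiff_smul_eq_zero (μ := volume.restrict Ω)
        (((hl (wgrad u)).sub (hl (wgrad v))).locallyIntegrableOn Ω) (fun η hη hc hs => by
          have hi : ∀ w : L2Vec Ω, IntegrableOn (fun x => η x • w x j) Ω := fun w =>
            (hl w).integrable_smul_left_of_hasCompactSupport hη.continuous hc
          simp only [Pi.sub_apply, smul_sub]
          rw [integral_sub (hi _) (hi _)]
          have h1 := integral_fderiv_smul_fn u η hη hc hs j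
          have h2 := integral_fderiv_smul_fn v η hη hc hs j
          rw [h, h2, neg_inj] at h1
          rw [h1, sub_self])
      filter_upwards [this, ae_restrict_mem hΩ.measurableSet] with x hx hxΩ using hx hxΩ
    refine Lp.ext ?_
    filter_upwards [ae_all_iff.2 hj] with x hx
    ext j
    exact sub_eq_zero.1 (hx j)
  exact Subtype.ext (WithLp.ofLp_injective 2 (Prod.ext h hg))

/-! ### The energy functional and the constrained minimization problem -/

/-- The value at `x` of `L_z u = -i (x ∂_y u - y ∂_x u)`, given the gradient `g` of `u` at `x`. -/
def angularMomentum (hd : 2 ≤ d) (x : Space d) (g : EuclideanSpace ℂ (Fin d)) : ℂ :=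
  -Complex.I * ((x (xDir hd) : ℂ) * g (yDir hd) - (x (yDir hd) : ℂ) * g (xDir hd))

/-- The density `ρ_i(Ψ) = k_{i1}|ψ₁|² + k_{i2}|ψ₂|²`. -/
def density {Ω : Set (Space d)} (K : Matrix (Fin 2) (Fin 2) ℝ) (Ψ : Fin 2 → H10 Ω)
    (i : Fin 2) (x : Space d) : ℝ :=
  ∑ j, K i j * ‖fn (Ψ j) x‖ ^ 2

/-- The energy density of the `i`-th component,
`½|∇ψ_i|² + V_i|ψ_i|² + ½ρ_i(Ψ)|ψ_i|² - ω_i Re(conj(ψ_i) L_z ψ_i)`. The real part is the usual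
convention: the integral of `conj(ψ_i) L_z ψ_i` is real, since `L_z` is symmetric on `H¹₀`. -/
def energyDensity (hd : 2 ≤ d) {Ω : Set (Space d)} (V : Fin 2 → Space d → ℝ) (ω : Fin 2 → ℝ)
    (K : Matrix (Fin 2) (Fin 2) ℝ) (Ψ : Fin 2 → H10 Ω) (i : Fin 2) (x : Space d) : ℝ :=
  1 / 2 * ‖wgrad (Ψ i) x‖ ^ 2 + V i x * ‖fn (Ψ i) x‖ ^ 2
    + 1 / 2 * density K Ψ i x * ‖fn (Ψ i) x‖ ^ 2
    - ω i * (starRingEnd ℂ (fn (Ψ i) x) * angularMomentum hd x (wgrad (Ψ i) x)).re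

/-- The coupled Gross-Pitaevskii energy with Josephson junction and rotation on `Ω`. -/
def energy (hd : 2 ≤ d) (Ω : Set (Space d)) (V : Fin 2 → Space d → ℝ) (ω : Fin 2 → ℝ)
    (β : ℝ) (K : Matrix (Fin 2) (Fin 2) ℝ) (Ψ : Fin 2 → H10 Ω) : ℝ :=
  (∑ i, ∫ x in Ω, energyDensity hd V ω K Ψ i x)
    + 2 * β * ∫ x in Ω, (fn (Ψ 0) x * starRingEnd ℂ (fn (Ψ 1) x)).re

/-- `E(Ψ) < ∞`: the energy integrals converge. (The Josephson integral always does, `ψ₁` and `ψ₂`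
being in `L²`.) -/
def FiniteEnergy (hd : 2 ≤ d) (Ω : Set (Space d)) (V : Fin 2 → Space d → ℝ) (ω : Fin 2 → ℝ)
    (K : Matrix (Fin 2) (Fin 2) ℝ) (Ψ : Fin 2 → H10 Ω) : Prop :=
  ∀ i, IntegrableOn (energyDensity hd V ω K Ψ i) Ω

/-- The norm of `[L²(Ω)]²`. -/
def l2Norm {Ω : Set (Space d)} (Ψ : Fin 2 → H10 Ω) : ℝ := √(∑ i, ‖fn (Ψ i)‖ ^ 2)

/-- The constraint set `M = {Ψ ∈ [H¹₀(Ω)]² | ‖Ψ‖_{L²} = 1, E(Ψ) < ∞}`. -/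
def constraintSet (hd : 2 ≤ d) (Ω : Set (Space d)) (V : Fin 2 → Space d → ℝ) (ω : Fin 2 → ℝ)
    (K : Matrix (Fin 2) (Fin 2) ℝ) : Set (Fin 2 → H10 Ω) :=
  {Ψ | l2Norm Ψ = 1 ∧ FiniteEnergy hd Ω V ω K Ψ}

/-- Assumption on the potentials: `V_i ∈ L^∞(Ω)`, and for some `α > 0`, almost everywhere in `Ω`,
`V_i(x) ≥ (1+α)/2 · ω_i² (x² + y²) + |β|`. -/
def PotentialAssumption (hd : 2 ≤ d) (Ω : Set (Space d)) (V : Fin 2 → Space d → ℝ)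
    (ω : Fin 2 → ℝ) (β : ℝ) : Prop :=
  (∀ i, MemLp (V i) ⊤ (volume.restrict Ω)) ∧
    ∃ α : ℝ, 0 < α ∧ ∀ i, ∀ᵐ x ∂(volume.restrict Ω),
      (1 + α) / 2 * ω i ^ 2 * (x (xDir hd) ^ 2 + x (yDir hd) ^ 2) + |β| ≤ V i x

/-- Assumption on the interaction matrix: symmetric, and either positive definite or with all
entries non-negative. -/
def InteractionAssumption (K : Matrix (Fin 2) (Fin 2) ℝ) : Prop :=
  K.IsSymm ∧ (K.PosDef ∨ ∀ i j, 0 ≤ K i j)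

end TwoComponentBEC

end

/-!
The minimizer is found by the direct method. Write the kinetic and the rotational energy together as
the square of the magnetic gradient `D_i u = ∇u - i ω_i (-y, x, 0, …, 0) u`, at the price of the
centrifugal potential `½ ω_i² (x² + y²)` (`norm_sub_smul_rotField_sq`). Then (`energy_eq`)
`E(Ψ) = ∑ ½ ‖D_i ψ_i‖² + ∫ F(x, Ψ(x))`, where the density `F`, consisting of the lowered trapping
potential, the Josephson term and the interaction, is non-negative by the two assumptions
(`localDensity_nonneg`). Hence `E ≥ 0`, and along a minimizing sequence the norms `‖D_i ψ_i‖` are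
bounded; as `Ω` is bounded, so are the norms in `H¹`.

A subsequence converges weakly in `H¹₀(Ω)` (`exists_subseq_tendsto_weakly`), strongly in `L²(Ω)`
by the Rellich-Kondrachov theorem (`tendsto_fst_of_tendsto_weakly`), and almost everywhere. Strong
convergence preserves the mass constraint, weak convergence makes `‖D_i ψ_i‖` lower semicontinuous,
and Fatou's lemma handles `∫ F`, including the quartic interaction, which no Sobolev embedding
controls in high dimension. Finally each interaction density of the limit is integrable
because both are dominated by their sum (`exists_abs_interaction_le`).

Rellich-Kondrachov is proved by Fourier analysis. For `u ∈ H¹₀(Ω)` extended by zero, Plancherel's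
theorem gives `‖u‖² ≤ ∫_{|ξ| ≤ R} |û(ξ)|² dξ + R⁻² ‖∇u‖²` (`norm_fst_sq_le_of_mem_H10`), and each
`û(ξ)` is a continuous linear functional of `u ∈ L²(Ω)`, bounded uniformly in `ξ`. Along a weakly
null sequence the integral therefore tends to zero for every `R` by dominated convergence.
-/

noncomputable section

namespace TwoComponentBEC

/-! ### Weak compactness in Hilbert spaces -/

open Filter Topology
open scoped FourierTransform

/-- A bounded sequence in a closed subspace `S` of a Hilbert space has a subsequence that converges
weakly to an element of `S`. The space need not be separable: the closed span of the sequence is,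
and the sequential Banach-Alaoglu theorem applies there. -/
theorem exists_subseq_tendsto_weakly {H : Type*} [NormedAddCommGroup H] [InnerProductSpace ℂ H]
    [CompleteSpace H] {S : Submodule ℂ H} (hS : IsClosed (S : Set H)) {u : ℕ → H}
    (huS : ∀ n, u n ∈ S) {C : ℝ} (hu : ∀ n, ‖u n‖ ≤ C) :
    ∃ v ∈ S, ∃ φ : ℕ → ℕ, StrictMono φ ∧
      ∀ ℓ : H →L[ℂ] ℂ, Tendsto (fun n => ℓ (u (φ n))) atTop (𝓝 (ℓ v)) := by
  let T : Submodule ℂ H := (Submodule.span ℂ (Set.range u)).topologicalClosure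
  have hTS : T ≤ S := Submodule.topologicalClosure_minimal _
    (Submodule.span_le.2 (Set.range_subset_iff.2 huS)) hS
  have huT : ∀ n, u n ∈ T := fun n =>
    Submodule.le_topologicalClosure _ (Submodule.subset_span ⟨n, rfl⟩)
  have : CompleteSpace T := (Submodule.isClosed_topologicalClosure _).completeSpace_coe
  have : TopologicalSpace.SeparableSpace T :=
    ((Set.countable_range u).isSeparable.span (R := ℂ)).closure.separableSpace
  let w : ℕ → T := fun n => ⟨u n, huT n⟩
  obtain ⟨f, -, φ, hφ, hlim⟩ := WeakDual.isSeqCompact_closedBall ℂ T 0 C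
    (x := fun n => StrongDual.toWeakDual (InnerProductSpace.toDual ℂ T (w n)))
    (fun n => by simpa [w] using hu n)
  let v : T := (InnerProductSpace.toDual ℂ T).symm (WeakDual.toStrongDual f)
  refine ⟨v, hTS v.2, φ, hφ, fun ℓ => ?_⟩
  let z : T := (InnerProductSpace.toDual ℂ T).symm (ℓ.comp T.subtypeL)
  have hz : ∀ x : T, ℓ x = inner ℂ z x := fun x => by simp [z]
  have hev := ((WeakDual.eval_continuous z).tendsto f).comp hlim
  have h1 : f z = inner ℂ v z := by
    rw [InnerProductSpace.toDual_symm_apply]; rfl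
  rw [h1] at hev
  have h2 := (Complex.continuous_conj.tendsto _).comp hev
  rw [inner_conj_symm] at h2
  rw [hz v]
  refine h2.congr fun n => ?_
  have : inner ℂ z (w (φ n)) = ℓ (u (φ n)) := (hz (w (φ n))).symm
  rw [← this, ← inner_conj_symm]
  rfl

/-- The norm is weakly sequentially lower semicontinuous. -/
theorem norm_le_of_tendsto_weakly {H : Type*} [NormedAddCommGroup H] [InnerProductSpace ℂ H]
    {u : ℕ → H} {v : H} {a : ℝ} (hu : Tendsto (fun n => inner ℂ v (u n)) atTop (𝓝 (inner ℂ v v)))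
    (ha : Tendsto (fun n => ‖u n‖) atTop (𝓝 a)) : ‖v‖ ≤ a := by
  have h : ‖v‖ * ‖v‖ ≤ ‖v‖ * a := by
    have := le_of_tendsto_of_tendsto' hu.norm (ha.const_mul ‖v‖) fun n => norm_inner_le_norm _ _
    simpa [inner_self_eq_norm_sq_to_K, sq] using this
  rcases (norm_nonneg v).eq_or_lt with h0 | h0
  · rw [← h0]
    exact ge_of_tendsto' ha fun n => norm_nonneg _
  · exact le_of_mul_le_mul_left h h0

variable {d : ℕ} {Ω : Set (Space d)}

theorem norm_sq_eq_integral {E : Type*} [NormedAddCommGroup E] [InnerProductSpace ℂ E]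
    {α : Type*} [MeasurableSpace α] {μ : Measure α} (f : Lp E 2 μ) :
    ‖f‖ ^ 2 = ∫ x, ‖f x‖ ^ 2 ∂μ := by
  have h : inner ℂ f f = ∫ x, inner ℂ (f x) (f x) ∂μ := L2.inner_def f f
  simp only [inner_self_eq_norm_sq_to_K] at h
  have h' : ((‖f‖ ^ 2 : ℝ) : ℂ) = ((∫ x, ‖f x‖ ^ 2 ∂μ : ℝ) : ℂ) := by
    rw [← integral_complex_ofReal]
    simpa using h
  exact_mod_cast h'

/-! ### Fourier coefficients and the Rellich-Kondrachov theorem -/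

theorem memLp_fourierChar [IsFiniteMeasure (volume.restrict Ω)] (ξ : Space d) :
    MemLp (fun x : Space d => ((Real.fourierChar (inner ℝ x ξ) : Circle) : ℂ)) 2
      (volume.restrict Ω) := by
  refine MemLp.of_bound (Continuous.aestronglyMeasurable ?_) 1 (ae_of_all _ fun x => (Circle.norm_coe _).le)
  exact continuous_subtype_val.comp (Real.continuous_fourierChar.comp (by fun_prop))

/-- The Fourier transform at frequency `ξ` of the extension by zero of `f ∈ L²(Ω)`, as a continuous
linear functional of `f`; it is represented by the plane wave `x ↦ exp(2πi⟨x, ξ⟩)`, which is in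
`L²(Ω)` for `Ω` of finite measure. -/
def fourierCoeff (Ω : Set (Space d)) [IsFiniteMeasure (volume.restrict Ω)] (ξ : Space d) :
    L2 Ω →L[ℂ] ℂ :=
  innerSL ℂ ((memLp_fourierChar (Ω := Ω) ξ).toLp _)

theorem fourierCoeff_apply [IsFiniteMeasure (volume.restrict Ω)] (ξ : Space d) (f : L2 Ω) :
    fourierCoeff Ω ξ f = ∫ x in Ω, Real.fourierChar (-inner ℝ x ξ) • f x := by
  rw [fourierCoeff, innerSL_apply_apply, L2.inner_def]
  refine integral_congr_ae ((memLp_fourierChar (Ω := Ω) ξ).coeFn_toLp.mono fun x hx => ?_)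
  simp only [hx]
  simp [Circle.smul_def, AddChar.map_neg_eq_inv, mul_comm]

theorem exists_norm_fourierCoeff_le (Ω : Set (Space d)) [IsFiniteMeasure (volume.restrict Ω)] :
    ∃ C : ℝ, ∀ ξ, ‖fourierCoeff Ω ξ‖ ≤ C := by
  refine ⟨measureUnivNNReal (volume.restrict Ω) ^ (2 : ENNReal).toReal⁻¹ * 1, fun ξ => ?_⟩
  rw [fourierCoeff, innerSL_apply_norm]
  refine Lp.norm_le_of_ae_bound zero_le_one ?_
  filter_upwards [(memLp_fourierChar (Ω := Ω) ξ).coeFn_toLp] with x hx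
  rw [hx]
  exact (Circle.norm_coe _).le

theorem continuous_fourierCoeff [IsFiniteMeasure (volume.restrict Ω)] (f : L2 Ω) :
    Continuous fun ξ => fourierCoeff Ω ξ f := by
  simp only [fourierCoeff_apply]
  have hf : Integrable f (volume.restrict Ω) := (Lp.memLp f).integrable (by norm_num)
  exact VectorFourier.fourierIntegral_continuous (L := innerₗ (Space d))
    Real.continuous_fourierChar (by simpa using continuous_inner) hf

/-- The low-frequency energy is continuous along bounded, weakly convergent sequences. -/
theorem tendsto_integral_fourierCoeff [IsFiniteMeasure (volume.restrict Ω)] {f : ℕ → L2 Ω}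
    {g : L2 Ω} {C : ℝ} (hC : ∀ n, ‖f n‖ ≤ C)
    (hf : ∀ ℓ : L2 Ω →L[ℂ] ℂ, Tendsto (fun n => ℓ (f n)) atTop (𝓝 (ℓ g))) (R : ℝ) :
    Tendsto (fun n => ∫ ξ in Metric.closedBall 0 R, ‖fourierCoeff Ω ξ (f n)‖ ^ 2) atTop
      (𝓝 (∫ ξ in Metric.closedBall 0 R, ‖fourierCoeff Ω ξ g‖ ^ 2)) := by
  obtain ⟨A, hA⟩ := exists_norm_fourierCoeff_le Ω
  have : IsFiniteMeasure (volume.restrict (Metric.closedBall (0 : Space d) R)) :=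
    ⟨by simpa using measure_closedBall_lt_top⟩
  refine tendsto_integral_of_dominated_convergence (fun _ => (A * C) ^ 2)
    (fun n => ((continuous_fourierCoeff (f n)).norm.pow 2).aestronglyMeasurable)
    (integrable_const _) (fun n => ae_of_all _ fun ξ => ?_)
    (ae_of_all _ fun ξ => (hf (fourierCoeff Ω ξ)).norm.pow 2)
  rw [Real.norm_of_nonneg (by positivity)]
  gcongr
  exact ((fourierCoeff Ω ξ).le_opNorm _).trans
    (mul_le_mul (hA ξ) (hC n) (norm_nonneg _) ((norm_nonneg _).trans (hA ξ)))

theorem norm_sq_eq_sum (ξ : Space d) : ‖ξ‖ ^ 2 = ∑ j, inner ℝ ξ (EuclideanSpace.single j 1) ^ 2 := by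
  rw [EuclideanSpace.norm_sq_eq]
  simp [EuclideanSpace.inner_single_right]

open LineDeriv SchwartzMap in
/-- Plancherel's theorem splits the `L²` norm of a Schwartz function into its low frequencies
and a remainder controlled by the gradient. -/
theorem integral_norm_sq_le_fourier (f : 𝓢(Space d, ℂ)) {R : ℝ} (hR : 0 < R) :
    ∫ x, ‖f x‖ ^ 2 ≤ (∫ ξ in Metric.closedBall 0 R, ‖𝓕 f ξ‖ ^ 2)
      + (R ^ 2)⁻¹ * ∑ j, ∫ x, ‖fderiv ℝ f x (EuclideanSpace.single j 1)‖ ^ 2 := by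
  have hi : ∀ g : 𝓢(Space d, ℂ), Integrable fun x => ‖g x‖ ^ 2 := fun g =>
    (g.memLp 2 volume).integrable_norm_pow (p := 2) two_ne_zero
  let D : Fin d → 𝓢(Space d, ℂ) := fun j => ∂_{(EuclideanSpace.single j (1 : ℝ) : Space d)} f
  have hD : ∀ j, ∫ x, ‖fderiv ℝ f x (EuclideanSpace.single j 1)‖ ^ 2 = ∫ ξ, ‖𝓕 (D j) ξ‖ ^ 2 :=
    fun j => by simp [integral_norm_sq_fourier, D, lineDerivOp_apply_eq_fderiv]
  have hDξ : ∀ j ξ, inner ℝ ξ (EuclideanSpace.single j (1 : ℝ)) ^ 2 * ‖𝓕 f ξ‖ ^ 2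
      ≤ ‖𝓕 (D j) ξ‖ ^ 2 := by
    intro j ξ
    have ht : Function.HasTemperateGrowth
        (fun x : Space d => inner ℝ x (EuclideanSpace.single j (1 : ℝ))) :=
      ((innerSL ℝ).flip _).hasTemperateGrowth
    simp only [D, fourier_lineDerivOp_eq, smul_apply, smulLeftCLM_apply_apply ht,
      norm_smul, mul_pow, norm_mul, Complex.norm_I, Complex.norm_real, Real.norm_eq_abs, sq_abs,
      Complex.norm_ofNat]
    -- The factor `(2π)²` from differentiation is at least `1` and is dropped.
    have hpi : (1 : ℝ) ≤ Real.pi ^ 2 := by nlinarith [Real.pi_gt_three]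
    nlinarith [mul_nonneg (sq_nonneg (inner ℝ ξ (EuclideanSpace.single j (1 : ℝ))))
      (sq_nonneg ‖𝓕 f ξ‖)]
  simp only [hD]
  rw [← integral_norm_sq_fourier, ← integral_finsetSum _ fun j _ => hi _, ← integral_const_mul,
    ← integral_indicator measurableSet_closedBall, ← integral_add]
  · refine integral_mono (hi _) (((hi _).indicator measurableSet_closedBall).add
      ((integrable_finsetSum _ fun j _ => hi _).const_mul _)) fun ξ => ?_
    have hs : 0 ≤ ∑ j, ‖𝓕 (D j) ξ‖ ^ 2 := Finset.sum_nonneg fun _ _ => by positivity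
    by_cases hξ : ξ ∈ Metric.closedBall (0 : Space d) R
    · simp only [Set.indicator_of_mem hξ]
      nlinarith [mul_nonneg (inv_nonneg.2 (sq_nonneg R)) hs]
    · simp only [Set.indicator_of_notMem hξ, zero_add]
      have hRξ : R ^ 2 ≤ ‖ξ‖ ^ 2 := by
        have : R < ‖ξ‖ := by simpa using hξ
        gcongr
      rw [inv_mul_eq_div, le_div_iff₀ (by positivity)]
      calc ‖𝓕 f ξ‖ ^ 2 * R ^ 2 ≤ ‖ξ‖ ^ 2 * ‖𝓕 f ξ‖ ^ 2 := by rw [mul_comm]; gcongr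
        _ ≤ _ := by
          rw [norm_sq_eq_sum, Finset.sum_mul]
          exact Finset.sum_le_sum fun j _ => hDξ j ξ
  · exact (hi _).indicator measurableSet_closedBall
  · exact (integrable_finsetSum _ fun j _ => hi _).const_mul _

theorem norm_sq_le_of_mem_testPairs [IsFiniteMeasure (volume.restrict Ω)] {p : L2Pair Ω}
    (hp : p ∈ testPairs Ω) {R : ℝ} (hR : 0 < R) :
    ‖p.fst‖ ^ 2 ≤ (∫ ξ in Metric.closedBall 0 R, ‖fourierCoeff Ω ξ p.fst‖ ^ 2)
      + (R ^ 2)⁻¹ * ‖p.snd‖ ^ 2 := by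
  obtain ⟨φ, hφ, h1, h2⟩ := hp
  let f : SchwartzMap (Space d) ℂ := hφ.compact.toSchwartzMap hφ.smooth
  have hf : ∀ x, f x = φ x := fun x => rfl
  have hφ0 : ∀ x ∉ Ω, φ x = 0 := fun x hx =>
    image_eq_zero_of_notMem_tsupport fun h => hx (hφ.support h)
  have hD0 : ∀ x ∉ Ω, fderiv ℝ φ x = 0 := fun x hx =>
    image_eq_zero_of_notMem_tsupport fun h => hx (hφ.support (tsupport_fderiv_subset ℝ h))
  have e1 : ‖p.fst‖ ^ 2 = ∫ x, ‖f x‖ ^ 2 := by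
    rw [norm_sq_eq_integral, ← setIntegral_eq_integral_of_forall_compl_eq_zero (s := Ω)
      (f := fun x => ‖f x‖ ^ 2)]
    · exact integral_congr_ae (h1.mono fun x hx => by simp only [hx, hf])
    · intro x hx
      simp [hf, hφ0 x hx]
  have e2 : ∀ ξ, fourierCoeff Ω ξ p.fst = 𝓕 f ξ := by
    intro ξ
    rw [fourierCoeff_apply, SchwartzMap.fourier_coe, Real.fourier_eq,
      ← setIntegral_eq_integral_of_forall_compl_eq_zero (s := Ω)
      (f := fun x => Real.fourierChar (-inner ℝ x ξ) • f x)]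
    · exact integral_congr_ae (h1.mono fun x hx => by simp only [hx, hf])
    · intro x hx
      simp [hf, hφ0 x hx]
  have e3 : ‖p.snd‖ ^ 2 = ∑ j, ∫ x, ‖fderiv ℝ f x (EuclideanSpace.single j 1)‖ ^ 2 := by
    rw [norm_sq_eq_integral, ← integral_finsetSum,
      ← setIntegral_eq_integral_of_forall_compl_eq_zero (s := Ω)
      (f := fun x => ∑ j, ‖fderiv ℝ f x (EuclideanSpace.single j 1)‖ ^ 2)]
    · exact integral_congr_ae (h2.mono fun x hx => by
        simp only [hx, classicalGrad, EuclideanSpace.norm_sq_eq]; rfl)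
    · intro x hx
      have : fderiv ℝ f x = 0 := hD0 x hx
      simp [this]
    · intro j _
      have := ((LineDeriv.lineDerivOp (EuclideanSpace.single j (1 : ℝ) : Space d) f).memLp 2
        volume).integrable_norm_pow (p := 2) two_ne_zero
      simpa only [SchwartzMap.lineDerivOp_apply_eq_fderiv] using this
  rw [e1, e3]
  simp only [e2]
  exact integral_norm_sq_le_fourier f hR

/-- For `u ∈ H¹₀(Ω)`, the `L²` norm is controlled by the frequencies `|ξ| ≤ R`, up to
`R⁻¹ ‖∇u‖`. -/
theorem norm_fst_sq_le_of_mem_H10 [IsFiniteMeasure (volume.restrict Ω)] {p : L2Pair Ω}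
    (hp : p ∈ H10 Ω) {R : ℝ} (hR : 0 < R) :
    ‖p.fst‖ ^ 2 ≤ (∫ ξ in Metric.closedBall 0 R, ‖fourierCoeff Ω ξ p.fst‖ ^ 2)
      + (R ^ 2)⁻¹ * ‖p.snd‖ ^ 2 := by
  obtain ⟨q, hq, hlim⟩ := mem_closure_iff_seq_limit.1
    (show p ∈ closure (testPairs Ω : Set (L2Pair Ω)) from hp)
  have h1 : Tendsto (fun n => (q n).fst) atTop (𝓝 p.fst) :=
    ((WithLp.fstL 2 ℂ (L2 Ω) (L2Vec Ω)).continuous.tendsto p).comp hlim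
  have h2 : Tendsto (fun n => (q n).snd) atTop (𝓝 p.snd) :=
    ((WithLp.sndL 2 ℂ (L2 Ω) (L2Vec Ω)).continuous.tendsto p).comp hlim
  obtain ⟨C, hC⟩ := h1.norm.bddAbove_range
  exact le_of_tendsto_of_tendsto' (h1.norm.pow 2)
    ((tendsto_integral_fourierCoeff (fun n => hC ⟨n, rfl⟩)
      (fun ℓ => (ℓ.continuous.tendsto _).comp h1) R).add ((h2.norm.pow 2).const_mul _))
    fun n => norm_sq_le_of_mem_testPairs (hq n) hR

/-- Rellich-Kondrachov: weak convergence in `H¹₀(Ω)` of a bounded sequence implies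
strong convergence in `L²(Ω)` when `Ω` has finite measure. -/
theorem tendsto_fst_of_tendsto_weakly [IsFiniteMeasure (volume.restrict Ω)] {u : ℕ → L2Pair Ω}
    {v : L2Pair Ω} (hu : ∀ n, u n ∈ H10 Ω) (hv : v ∈ H10 Ω) {C : ℝ} (hC : ∀ n, ‖u n‖ ≤ C)
    (hlim : ∀ ℓ : L2Pair Ω →L[ℂ] ℂ, Tendsto (fun n => ℓ (u n)) atTop (𝓝 (ℓ v))) :
    Tendsto (fun n => (u n).fst) atTop (𝓝 v.fst) := by
  let w : ℕ → L2Pair Ω := fun n => u n - v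
  have hw : ∀ n, w n ∈ H10 Ω := fun n => (H10 Ω).sub_mem (hu n) hv
  have hwC : ∀ n, ‖w n‖ ≤ C + ‖v‖ := fun n => (norm_sub_le _ _).trans (by gcongr; exact hC n)
  have hweak : ∀ ℓ : L2 Ω →L[ℂ] ℂ, Tendsto (fun n => ℓ (w n).fst) atTop (𝓝 (ℓ 0)) := by
    intro ℓ
    have := (hlim (ℓ.comp (WithLp.fstL 2 ℂ (L2 Ω) (L2Vec Ω)))).sub_const
      (ℓ.comp (WithLp.fstL 2 ℂ (L2 Ω) (L2Vec Ω)) v)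
    simpa [w] using this
  suffices h : Tendsto (fun n => ‖(w n).fst‖ ^ 2) atTop (𝓝 0) by
    rw [tendsto_iff_norm_sub_tendsto_zero]
    have h' := h.sqrt
    simpa [w, Real.sqrt_sq (norm_nonneg _)] using h'
  rw [tendsto_order]
  refine ⟨fun a ha => Eventually.of_forall fun n => ha.trans_le (by positivity), fun ε hε => ?_⟩
  obtain ⟨R, hR, hRε⟩ : ∃ R : ℝ, 0 < R ∧ (R ^ 2)⁻¹ * (C + ‖v‖) ^ 2 < ε / 2 := by
    have : Tendsto (fun R : ℝ => (R ^ 2)⁻¹ * (C + ‖v‖) ^ 2) atTop (𝓝 (0 * (C + ‖v‖) ^ 2)) :=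
      (tendsto_inv_atTop_zero.comp (tendsto_pow_atTop two_ne_zero)).mul_const _
    rw [zero_mul] at this
    exact ((eventually_gt_atTop 0).and (this.eventually (gt_mem_nhds (half_pos hε)))).exists
  have hlow := tendsto_integral_fourierCoeff (fun n => (WithLp.norm_fst_le _ (w n)).trans (hwC n)) hweak R
  simp only [map_zero, norm_zero, ne_eq, OfNat.ofNat_ne_zero, not_false_eq_true, zero_pow,
    integral_zero] at hlow
  filter_upwards [hlow.eventually (gt_mem_nhds (half_pos hε))] with n hn
  have h2 : (R ^ 2)⁻¹ * ‖(w n).snd‖ ^ 2 ≤ (R ^ 2)⁻¹ * (C + ‖v‖) ^ 2 := by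
    gcongr
    exact (WithLp.norm_snd_le _ (w n)).trans (hwC n)
  linarith [norm_fst_sq_le_of_mem_H10 (hw n) hR]

/-! ### The magnetic gradient -/

/-- The vector field `i c (-y, x, 0, …, 0)`, the vector potential of a rotation of angular
velocity `c`. -/
def rotField (hd : 2 ≤ d) (c : ℝ) (x : Space d) : EuclideanSpace ℂ (Fin d) :=
  (Complex.I * c) • (EuclideanSpace.single (yDir hd) (x (xDir hd) : ℂ)
    - EuclideanSpace.single (xDir hd) (x (yDir hd) : ℂ))

theorem continuous_rotField (hd : 2 ≤ d) (c : ℝ) : Continuous (rotField hd c) := by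
  have h : ∀ j : Fin d, Continuous fun z : ℂ => EuclideanSpace.single j z := fun j =>
    (PiLp.continuous_toLp 2 _).comp (continuous_single (A := fun _ => ℂ) j)
  have hs : ∀ j i : Fin d, Continuous fun x : Space d => EuclideanSpace.single j (x i : ℂ) :=
    fun j i => (h j).comp (show Continuous fun x : Space d => ((x i : ℝ) : ℂ) by fun_prop)
  exact ((hs _ _).sub (hs _ _)).const_smul (Complex.I * c)

theorem norm_rotField_sq (hd : 2 ≤ d) (c : ℝ) (x : Space d) :
    ‖rotField hd c x‖ ^ 2 = c ^ 2 * (x (xDir hd) ^ 2 + x (yDir hd) ^ 2) := by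
  have hne : xDir hd ≠ yDir hd := by simp [xDir, yDir]
  rw [rotField, norm_smul, mul_pow, @norm_sub_sq ℂ]
  simp [EuclideanSpace.inner_single_left, hne]

/-- Completing the square: the kinetic and rotational energy densities are those of a magnetic
gradient, up to a centrifugal potential. -/
theorem norm_sub_smul_rotField_sq (hd : 2 ≤ d) (c : ℝ) (x : Space d)
    (g : EuclideanSpace ℂ (Fin d)) (z : ℂ) :
    ‖g - z • rotField hd c x‖ ^ 2 = ‖g‖ ^ 2
      - 2 * c * (starRingEnd ℂ z * angularMomentum hd x g).re
      + c ^ 2 * (x (xDir hd) ^ 2 + x (yDir hd) ^ 2) * ‖z‖ ^ 2 := by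
  have hin : inner ℂ (z • rotField hd c x) g = c * (starRingEnd ℂ z * angularMomentum hd x g) := by
    simp only [rotField, inner_smul_left, inner_sub_left, EuclideanSpace.inner_single_left,
      angularMomentum, map_mul, Complex.conj_I, Complex.conj_ofReal]
    ring
  have hre : RCLike.re (inner ℂ g (z • rotField hd c x))
      = c * (starRingEnd ℂ z * angularMomentum hd x g).re := by
    rw [inner_re_symm, hin]
    simp only [RCLike.re_to_complex, Complex.re_ofReal_mul]
  rw [@norm_sub_sq ℂ, hre, norm_smul, mul_pow, norm_rotField_sq]
  ring

/-- Multiplication by `rotField` is a bounded operator on `L²(Ω)`, since the field is bounded on the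
bounded set `Ω`. -/
theorem exists_multiplication_rotField (hd : 2 ≤ d) (hΩ : Bornology.IsBounded Ω)
    (hm : MeasurableSet Ω) (c : ℝ) :
    ∃ M : L2 Ω →L[ℂ] L2Vec Ω, ∀ f : L2 Ω,
      M f =ᵐ[volume.restrict Ω] fun x => f x • rotField hd c x := by
  obtain ⟨C, hC⟩ := (hΩ.isCompact_closure.image (continuous_rotField hd c)).isBounded
    |>.exists_norm_le
  have hb : MemLp (rotField hd c) ⊤ (volume.restrict Ω) := by
    refine memLp_top_of_bound (continuous_rotField hd c).aestronglyMeasurable C ?_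
    filter_upwards [ae_restrict_mem hm] with x hx using hC _ ⟨x, subset_closure hx, rfl⟩
  let B : EuclideanSpace ℂ (Fin d) →L[ℂ] ℂ →L[ℂ] EuclideanSpace ℂ (Fin d) :=
    (ContinuousLinearMap.lsmul ℂ ℂ).flip
  refine ⟨B.holderL (volume.restrict Ω) ⊤ 2 2 (hb.toLp _), fun f => ?_⟩
  rw [ContinuousLinearMap.holderL_apply_apply]
  filter_upwards [B.coeFn_holder (r := 2) (hb.toLp _) f, hb.coeFn_toLp] with x h1 h2
  rw [h1, h2]
  rfl

/-- Compactness in `H¹₀(Ω)`, in the form used for minimizing sequences: the functions converge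
strongly and pointwise, while for the magnetic gradient only the norm is controlled in the limit. -/
theorem exists_subseq_tendsto_fn [IsFiniteMeasure (volume.restrict Ω)] (M : L2 Ω →L[ℂ] L2Vec Ω)
    {u : ℕ → H10 Ω} {C : ℝ} (hu : ∀ n, ‖fn (u n)‖ ≤ C)
    (hg : ∀ n, ‖wgrad (u n) - M (fn (u n))‖ ≤ C) :
    ∃ (v : H10 Ω) (φ : ℕ → ℕ) (a : ℝ), StrictMono φ ∧
      Tendsto (fun n => fn (u (φ n))) atTop (𝓝 (fn v)) ∧
      (∀ᵐ x ∂(volume.restrict Ω), Tendsto (fun n => fn (u (φ n)) x) atTop (𝓝 (fn v x))) ∧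
      Tendsto (fun n => ‖wgrad (u (φ n)) - M (fn (u (φ n)))‖) atTop (𝓝 a) ∧
      ‖wgrad v - M (fn v)‖ ≤ a := by
  have hC0 : 0 ≤ C := (norm_nonneg _).trans (hu 0)
  have hbd : ∀ n, ‖(u n : L2Pair Ω)‖ ≤ C + (C + ‖M‖ * C) := by
    intro n
    have h1 : ‖wgrad (u n)‖ ≤ C + ‖M‖ * C := by
      calc ‖wgrad (u n)‖ = ‖(wgrad (u n) - M (fn (u n))) + M (fn (u n))‖ := by simp
        _ ≤ _ := (norm_add_le _ _).trans
          (add_le_add (hg n) ((M.le_opNorm _).trans (by gcongr; exact hu n)))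
    have h2 := WithLp.prod_norm_sq_eq_of_L2 (u n : L2Pair Ω)
    change _ = ‖fn (u n)‖ ^ 2 + ‖wgrad (u n)‖ ^ 2 at h2
    refine le_trans (b := ‖fn (u n)‖ + ‖wgrad (u n)‖)
      (abs_le_of_sq_le_sq' ?_ (by positivity) |>.2) (add_le_add (hu n) h1)
    nlinarith [norm_nonneg (fn (u n)), norm_nonneg (wgrad (u n))]
  obtain ⟨v, hv, φ, hφ, hweak⟩ := exists_subseq_tendsto_weakly
    (Submodule.isClosed_topologicalClosure (testPairs Ω)) (fun n => (u n).2) hbd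
  have hstrong := tendsto_fst_of_tendsto_weakly (fun n => (u (φ n)).2) hv
    (fun n => hbd (φ n)) hweak
  obtain ⟨ψ, hψ, hae⟩ := (tendstoInMeasure_of_tendsto_Lp hstrong).exists_seq_tendsto_ae
  obtain ⟨a, -, χ, hχ, hnorm⟩ := (isCompact_Icc (a := (0 : ℝ)) (b := C)).tendsto_subseq
    (x := fun n => ‖wgrad (u (φ (ψ n))) - M (fn (u (φ (ψ n))))‖)
    fun n => ⟨norm_nonneg _, hg _⟩
  refine ⟨⟨v, hv⟩, fun n => φ (ψ (χ n)), a, hφ.comp (hψ.comp hχ),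
    hstrong.comp (hψ.comp hχ).tendsto_atTop, ?_, hnorm, ?_⟩
  · filter_upwards [hae] with x hx using hx.comp hχ.tendsto_atTop
  · refine norm_le_of_tendsto_weakly ?_ hnorm
    -- The magnetic gradient is a bounded linear map, hence weakly continuous.
    let D : L2Pair Ω →L[ℂ] L2Vec Ω := WithLp.sndL 2 ℂ (L2 Ω) (L2Vec Ω)
      - M.comp (WithLp.fstL 2 ℂ (L2 Ω) (L2Vec Ω))
    exact (hweak ((innerSL ℂ (D v)).comp D)).comp (hψ.comp hχ).tendsto_atTop

/-- Fatou's lemma for Bochner integrals of non-negative functions. -/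
theorem integrable_and_integral_le_of_tendsto_ae {α : Type*} [MeasurableSpace α] {μ : Measure α}
    {F : ℕ → α → ℝ} {G : α → ℝ} {c : ℝ} (hF : ∀ n, Integrable (F n) μ)
    (h0 : ∀ n, 0 ≤ᵐ[μ] F n) (hlim : ∀ᵐ x ∂μ, Tendsto (fun n => F n x) atTop (𝓝 (G x)))
    (hc : Tendsto (fun n => ∫ x, F n x ∂μ) atTop (𝓝 c)) :
    Integrable G μ ∧ ∫ x, G x ∂μ ≤ c := by
  have hG0 : 0 ≤ᵐ[μ] G := by
    filter_upwards [ae_all_iff.2 h0, hlim] with x h1 h2 using ge_of_tendsto' h2 h1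
  have hGm : AEStronglyMeasurable G μ :=
    aestronglyMeasurable_of_tendsto_ae _ (fun n => (hF n).aestronglyMeasurable) hlim
  have hc0 : 0 ≤ c := ge_of_tendsto' hc fun n => integral_nonneg_of_ae (h0 n)
  have key : ∫⁻ x, ENNReal.ofReal (G x) ∂μ ≤ ENNReal.ofReal c := by
    calc ∫⁻ x, ENNReal.ofReal (G x) ∂μ
        = ∫⁻ x, liminf (fun n => ENNReal.ofReal (F n x)) atTop ∂μ :=
          lintegral_congr_ae (hlim.mono fun x hx => (ENNReal.tendsto_ofReal hx).liminf_eq.symm)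
      _ ≤ liminf (fun n => ∫⁻ x, ENNReal.ofReal (F n x) ∂μ) atTop :=
          lintegral_liminf_le' fun n => (hF n).aestronglyMeasurable.aemeasurable.ennreal_ofReal
      _ = ENNReal.ofReal c := by
          refine ((ENNReal.tendsto_ofReal hc).congr fun n => ?_).liminf_eq
          exact ofReal_integral_eq_lintegral_ofReal (hF n) (h0 n)
  refine ⟨⟨hGm, (hasFiniteIntegral_iff_ofReal hG0).2 (key.trans_lt ENNReal.ofReal_lt_top)⟩, ?_⟩
  rw [integral_eq_lintegral_of_nonneg_ae hG0 hGm]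
  exact ENNReal.toReal_le_of_le_ofReal hc0 key

/-! ### The interaction and potential energies -/

theorem interaction_nonneg {K : Matrix (Fin 2) (Fin 2) ℝ} (hK : InteractionAssumption K)
    {a : Fin 2 → ℝ} (ha : ∀ i, 0 ≤ a i) : 0 ≤ ∑ i, (∑ j, K i j * a j) * a i := by
  rcases hK.2 with h | h
  · have := h.posSemidef.dotProduct_mulVec_nonneg a
    simp only [Matrix.mulVec, dotProduct, star_trivial] at this
    simpa only [mul_comm] using this
  · exact Finset.sum_nonneg fun i _ => mul_nonneg
      (Finset.sum_nonneg fun j _ => mul_nonneg (h i j) (ha j)) (ha i)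

/-- Each of the two interaction densities is controlled by their sum. For `K` positive definite with
a negative off-diagonal entry they need not be non-negative separately; there the sum controls
`|ψ₁|⁴ + |ψ₂|⁴`. -/
theorem exists_abs_interaction_le {K : Matrix (Fin 2) (Fin 2) ℝ} (hK : InteractionAssumption K) :
    ∃ C : ℝ, ∀ a : Fin 2 → ℝ, (∀ i, 0 ≤ a i) → ∀ i,
      |(∑ j, K i j * a j) * a i| ≤ C * ∑ i, (∑ j, K i j * a j) * a i := by
  rcases hK.2 with h | h
  · have hs : K 1 0 = K 0 1 := hK.1.apply 0 1
    have h0 : 0 < K 0 0 := h.diag_pos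
    have h1 : 0 < K 1 1 := h.diag_pos
    have hdet : 0 < K 0 0 * K 1 1 - K 0 1 * K 0 1 := by
      have := h.det_pos
      rwa [Matrix.det_fin_two, hs] at this
    refine ⟨(K 0 0 + |K 0 1| + K 1 1) * ((K 0 0 + K 1 1) / (K 0 0 * K 1 1 - K 0 1 * K 0 1)),
      fun a _ i => ?_⟩
    -- Completing the square both ways, `det K * a 1 ^ 2 ≤ K 0 0 * Q` and `det K * a 0 ^ 2 ≤ K 1 1 * Q`
    -- for the quadratic form `Q` of `K`.
    have hq : a 0 ^ 2 + a 1 ^ 2 ≤ (K 0 0 + K 1 1) / (K 0 0 * K 1 1 - K 0 1 * K 0 1)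
        * ∑ i, (∑ j, K i j * a j) * a i := by
      rw [div_mul_eq_mul_div, le_div_iff₀ hdet]
      simp only [Fin.sum_univ_two, hs]
      nlinarith [sq_nonneg (K 0 0 * a 0 + K 0 1 * a 1), sq_nonneg (K 1 1 * a 1 + K 0 1 * a 0)]
    rw [mul_assoc]
    refine le_trans ?_ (mul_le_mul_of_nonneg_left hq (by positivity))
    have hab : |a 0 * a 1| ≤ a 0 ^ 2 + a 1 ^ 2 := by
      rw [abs_le]
      constructor <;> nlinarith [sq_nonneg (a 0 + a 1), sq_nonneg (a 0 - a 1)]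
    have hcross : |K 0 1 * (a 0 * a 1)| ≤ |K 0 1| * (a 0 ^ 2 + a 1 ^ 2) := by
      rw [abs_mul]; gcongr
    have hcross' := abs_le.1 hcross
    rw [abs_le]
    fin_cases i <;> simp only [Fin.sum_univ_two, hs, Fin.zero_eta, Fin.mk_one] <;> constructor <;>
      nlinarith [mul_nonneg h0.le (sq_nonneg (a 0)), mul_nonneg h0.le (sq_nonneg (a 1)),
        mul_nonneg h1.le (sq_nonneg (a 0)), mul_nonneg h1.le (sq_nonneg (a 1))]
  · refine ⟨1, fun a ha i => ?_⟩
    have hn : ∀ i, 0 ≤ (∑ j, K i j * a j) * a i := fun i => mul_nonneg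
      (Finset.sum_nonneg fun j _ => mul_nonneg (h i j) (ha j)) (ha i)
    rw [abs_of_nonneg (hn i), one_mul]
    exact Finset.single_le_sum (f := fun i => (∑ j, K i j * a j) * a i) (fun i _ => hn i)
      (Finset.mem_univ i)

/-- The trapping potential lowered by the centrifugal potential. -/
def effPotential (hd : 2 ≤ d) (V : Fin 2 → Space d → ℝ) (ω : Fin 2 → ℝ) (i : Fin 2)
    (x : Space d) : ℝ :=
  V i x - 1 / 2 * (ω i ^ 2 * (x (xDir hd) ^ 2 + x (yDir hd) ^ 2))

/-- The potential and Josephson energy density of the values `z` at the point `x`. -/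
def quadDensity (hd : 2 ≤ d) (V : Fin 2 → Space d → ℝ) (ω : Fin 2 → ℝ) (β : ℝ)
    (x : Space d) (z : Fin 2 → ℂ) : ℝ :=
  ∑ i, effPotential hd V ω i x * ‖z i‖ ^ 2 + 2 * β * (z 0 * starRingEnd ℂ (z 1)).re

/-- The part of the energy density that depends on the values `z` only, not on the gradient. -/
def localDensity (hd : 2 ≤ d) (V : Fin 2 → Space d → ℝ) (ω : Fin 2 → ℝ) (β : ℝ)
    (K : Matrix (Fin 2) (Fin 2) ℝ) (x : Space d) (z : Fin 2 → ℂ) : ℝ :=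
  quadDensity hd V ω β x z + 1 / 2 * ∑ i, (∑ j, K i j * ‖z j‖ ^ 2) * ‖z i‖ ^ 2

theorem continuous_localDensity (hd : 2 ≤ d) (V : Fin 2 → Space d → ℝ) (ω : Fin 2 → ℝ) (β : ℝ)
    (K : Matrix (Fin 2) (Fin 2) ℝ) (x : Space d) : Continuous (localDensity hd V ω β K x) := by
  unfold localDensity quadDensity
  have : Continuous fun z : Fin 2 → ℂ => (z 0 * starRingEnd ℂ (z 1)).re :=
    Complex.continuous_re.comp
      ((continuous_apply 0).mul (Complex.continuous_conj.comp (continuous_apply 1)))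
  fun_prop

theorem quadDensity_nonneg {hd : 2 ≤ d} {V : Fin 2 → Space d → ℝ} {ω : Fin 2 → ℝ} {β : ℝ}
    (hV : PotentialAssumption hd Ω V ω β) :
    ∀ᵐ x ∂(volume.restrict Ω), ∀ z, 0 ≤ quadDensity hd V ω β x z := by
  obtain ⟨α, hα, h⟩ := hV.2
  filter_upwards [ae_all_iff.2 h] with x hx z
  have hW : ∀ i, |β| ≤ effPotential hd V ω i x := by
    intro i
    have h1 := hx i
    have h2 : 0 ≤ α * (ω i ^ 2 * (x (xDir hd) ^ 2 + x (yDir hd) ^ 2)) := by positivity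
    unfold effPotential
    linarith
  have hre : |(z 0 * starRingEnd ℂ (z 1)).re| ≤ ‖z 0‖ * ‖z 1‖ :=
    (Complex.abs_re_le_norm _).trans (by simp)
  have h3 : |2 * β * (z 0 * starRingEnd ℂ (z 1)).re| ≤ |β| * ‖z 0‖ ^ 2 + |β| * ‖z 1‖ ^ 2 := by
    rw [abs_mul, abs_mul, abs_two]
    nlinarith [mul_le_mul_of_nonneg_left hre (abs_nonneg β),
      mul_nonneg (abs_nonneg β) (sq_nonneg (‖z 0‖ - ‖z 1‖))]
  have h4 := (abs_le.1 h3).1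
  have h5 := mul_le_mul_of_nonneg_right (hW 0) (sq_nonneg ‖z 0‖)
  have h6 := mul_le_mul_of_nonneg_right (hW 1) (sq_nonneg ‖z 1‖)
  simp only [quadDensity, Fin.sum_univ_two]
  linarith

theorem localDensity_nonneg {hd : 2 ≤ d} {V : Fin 2 → Space d → ℝ} {ω : Fin 2 → ℝ} {β : ℝ}
    {K : Matrix (Fin 2) (Fin 2) ℝ} (hV : PotentialAssumption hd Ω V ω β)
    (hK : InteractionAssumption K) :
    ∀ᵐ x ∂(volume.restrict Ω), ∀ z, 0 ≤ localDensity hd V ω β K x z := by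
  filter_upwards [quadDensity_nonneg hV] with x hx z
  have := interaction_nonneg hK (a := fun i => ‖z i‖ ^ 2) fun i => by positivity
  exact add_nonneg (hx z) (by linarith)

theorem integrable_norm_sq {E : Type*} [NormedAddCommGroup E] {α : Type*} [MeasurableSpace α]
    {μ : Measure α} (f : Lp E 2 μ) : Integrable (fun x => ‖f x‖ ^ 2) μ :=
  (Lp.memLp f).integrable_norm_pow (p := 2) two_ne_zero

theorem integrable_josephson (u v : L2 Ω) :
    Integrable (fun x => (u x * starRingEnd ℂ (v x)).re) (volume.restrict Ω) :=
  ((Lp.memLp u).integrable_mul (Lp.memLp v).star).re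

theorem integrable_effPotential_mul (hd : 2 ≤ d) (hΩ : Bornology.IsBounded Ω)
    (hm : MeasurableSet Ω) {V : Fin 2 → Space d → ℝ} (ω : Fin 2 → ℝ)
    (hV : ∀ i, MemLp (V i) ⊤ (volume.restrict Ω)) (i : Fin 2) (u : L2 Ω) :
    Integrable (fun x => effPotential hd V ω i x * ‖u x‖ ^ 2) (volume.restrict Ω) := by
  have hc : Continuous fun x : Space d =>
      1 / 2 * (ω i ^ 2 * (x (xDir hd) ^ 2 + x (yDir hd) ^ 2)) := by fun_prop
  obtain ⟨C, hC⟩ := (hΩ.isCompact_closure.image hc).isBounded.exists_norm_le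
  have hr : MemLp (fun x : Space d => 1 / 2 * (ω i ^ 2 * (x (xDir hd) ^ 2 + x (yDir hd) ^ 2))) ⊤
      (volume.restrict Ω) := by
    refine memLp_top_of_bound hc.aestronglyMeasurable C ?_
    filter_upwards [ae_restrict_mem hm] with x hx using hC _ ⟨x, subset_closure hx, rfl⟩
  exact (integrable_norm_sq u).mul_of_top_right ((hV i).sub hr)

theorem energyDensity_ae_eq {hd : 2 ≤ d} {V : Fin 2 → Space d → ℝ} {ω : Fin 2 → ℝ}
    {K : Matrix (Fin 2) (Fin 2) ℝ} {M : Fin 2 → L2 Ω →L[ℂ] L2Vec Ω}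
    (hM : ∀ i f, M i f =ᵐ[volume.restrict Ω] fun x => f x • rotField hd (ω i) x)
    (Ψ : Fin 2 → H10 Ω) (i : Fin 2) :
    energyDensity hd V ω K Ψ i =ᵐ[volume.restrict Ω] fun x =>
      1 / 2 * ‖(wgrad (Ψ i) - M i (fn (Ψ i))) x‖ ^ 2 + effPotential hd V ω i x * ‖fn (Ψ i) x‖ ^ 2
        + 1 / 2 * (density K Ψ i x * ‖fn (Ψ i) x‖ ^ 2) := by
  filter_upwards [Lp.coeFn_sub (wgrad (Ψ i)) (M i (fn (Ψ i))), hM i (fn (Ψ i))] with x h1 h2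
  rw [h1, Pi.sub_apply, h2, norm_sub_smul_rotField_sq, energyDensity, effPotential]
  ring

/-- All other terms of the energy density being integrable on `H¹₀(Ω)`, only the interaction
densities decide whether the energy is finite. -/
theorem finiteEnergy_iff {hd : 2 ≤ d} {V : Fin 2 → Space d → ℝ} {ω : Fin 2 → ℝ}
    (hΩ : Bornology.IsBounded Ω) (hm : MeasurableSet Ω)
    (hV : ∀ i, MemLp (V i) ⊤ (volume.restrict Ω))
    {K : Matrix (Fin 2) (Fin 2) ℝ} {Ψ : Fin 2 → H10 Ω} :
    FiniteEnergy hd Ω V ω K Ψ ↔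
      ∀ i, IntegrableOn (fun x => density K Ψ i x * ‖fn (Ψ i) x‖ ^ 2) Ω := by
  choose M hM using fun i => exists_multiplication_rotField hd hΩ hm (ω i)
  refine forall_congr' fun i => ?_
  have h1 : IntegrableOn (fun x => 1 / 2 * ‖(wgrad (Ψ i) - M i (fn (Ψ i))) x‖ ^ 2
      + effPotential hd V ω i x * ‖fn (Ψ i) x‖ ^ 2) Ω :=
    ((integrable_norm_sq _).const_mul (1 / 2)).add
      (integrable_effPotential_mul hd hΩ hm ω hV i (fn (Ψ i)))
  rw [IntegrableOn, integrable_congr (energyDensity_ae_eq hM Ψ i),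
    integrable_add_iff_integrable_right' h1]
  exact integrable_const_mul_iff (by norm_num) _

theorem integrable_quadDensity {hd : 2 ≤ d} {V : Fin 2 → Space d → ℝ} {ω : Fin 2 → ℝ} {β : ℝ}
    (hΩ : Bornology.IsBounded Ω) (hm : MeasurableSet Ω)
    (hV : ∀ i, MemLp (V i) ⊤ (volume.restrict Ω)) (Ψ : Fin 2 → H10 Ω) :
    IntegrableOn (fun x => quadDensity hd V ω β x fun i => fn (Ψ i) x) Ω :=
  (integrable_finsetSum _ fun i _ =>
    integrable_effPotential_mul hd hΩ hm ω hV i (fn (Ψ i))).add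
    ((integrable_josephson (fn (Ψ 0)) (fn (Ψ 1))).const_mul _)

theorem integrable_localDensity {hd : 2 ≤ d} {V : Fin 2 → Space d → ℝ} {ω : Fin 2 → ℝ} {β : ℝ}
    {K : Matrix (Fin 2) (Fin 2) ℝ} (hΩ : Bornology.IsBounded Ω) (hm : MeasurableSet Ω)
    (hV : ∀ i, MemLp (V i) ⊤ (volume.restrict Ω)) {Ψ : Fin 2 → H10 Ω}
    (hΨ : FiniteEnergy hd Ω V ω K Ψ) :
    IntegrableOn (fun x => localDensity hd V ω β K x fun i => fn (Ψ i) x) Ω :=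
  (integrable_quadDensity hΩ hm hV Ψ).add
    ((integrable_finsetSum _ fun i _ => (finiteEnergy_iff hΩ hm hV).1 hΨ i).const_mul _)

/-- The energy is that of the magnetic gradient plus a local functional, whose density is
non-negative. -/
theorem energy_eq {hd : 2 ≤ d} {V : Fin 2 → Space d → ℝ} {ω : Fin 2 → ℝ} {β : ℝ}
    {K : Matrix (Fin 2) (Fin 2) ℝ} (hΩ : Bornology.IsBounded Ω) (hm : MeasurableSet Ω)
    (hV : ∀ i, MemLp (V i) ⊤ (volume.restrict Ω)) {M : Fin 2 → L2 Ω →L[ℂ] L2Vec Ω}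
    (hM : ∀ i f, M i f =ᵐ[volume.restrict Ω] fun x => f x • rotField hd (ω i) x)
    {Ψ : Fin 2 → H10 Ω} (hΨ : FiniteEnergy hd Ω V ω K Ψ) :
    energy hd Ω V ω β K Ψ = (∑ i, 1 / 2 * ‖wgrad (Ψ i) - M i (fn (Ψ i))‖ ^ 2)
      + ∫ x in Ω, localDensity hd V ω β K x fun i => fn (Ψ i) x := by
  have hρ := (finiteEnergy_iff hΩ hm hV).1 hΨ
  have hg := fun i => (integrable_norm_sq (wgrad (Ψ i) - M i (fn (Ψ i)))).const_mul (1 / 2)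
  have hW := fun i => integrable_effPotential_mul hd hΩ hm ω hV i (fn (Ψ i))
  have hi : ∀ i, ∫ x in Ω, energyDensity hd V ω K Ψ i x
      = 1 / 2 * ‖wgrad (Ψ i) - M i (fn (Ψ i))‖ ^ 2
        + (∫ x in Ω, effPotential hd V ω i x * ‖fn (Ψ i) x‖ ^ 2)
        + 1 / 2 * ∫ x in Ω, density K Ψ i x * ‖fn (Ψ i) x‖ ^ 2 := by
    intro i
    have hgW : IntegrableOn (fun x => 1 / 2 * ‖(wgrad (Ψ i) - M i (fn (Ψ i))) x‖ ^ 2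
        + effPotential hd V ω i x * ‖fn (Ψ i) x‖ ^ 2) Ω := (hg i).add (hW i)
    rw [integral_congr_ae (energyDensity_ae_eq hM Ψ i),
      integral_add hgW ((hρ i).const_mul _), integral_add (hg i) (hW i),
      integral_const_mul, integral_const_mul, norm_sq_eq_integral]
  have hl : ∫ x in Ω, localDensity hd V ω β K x (fun i => fn (Ψ i) x)
      = (∑ i, ∫ x in Ω, effPotential hd V ω i x * ‖fn (Ψ i) x‖ ^ 2)
        + 2 * β * (∫ x in Ω, (fn (Ψ 0) x * starRingEnd ℂ (fn (Ψ 1) x)).re)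
        + 1 / 2 * ∑ i, ∫ x in Ω, density K Ψ i x * ‖fn (Ψ i) x‖ ^ 2 := by
    rw [← integral_finsetSum _ fun i _ => hW i, ← integral_finsetSum _ fun i _ => hρ i,
      ← integral_const_mul, ← integral_const_mul, ← integral_add, ← integral_add]
    · rfl
    · exact integrable_quadDensity hΩ hm hV Ψ
    · exact (integrable_finsetSum _ fun i _ => hρ i).const_mul _
    · exact integrable_finsetSum _ fun i _ => hW i
    · exact (integrable_josephson _ _).const_mul _
  rw [energy, hl]
  simp only [hi, Finset.sum_add_distrib, Finset.mul_sum]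
  ring

/-! ### Existence of a minimizer -/

/-- A smooth bump function in `Ω`, normalized in `L²`. -/
theorem exists_mem_testPairs_norm_fst_eq_one (ho : IsOpen Ω) (hne : Ω.Nonempty) :
    ∃ p ∈ testPairs Ω, ‖p.fst‖ = 1 := by
  obtain ⟨x₀, hx₀⟩ := hne
  obtain ⟨ε, hε, hball⟩ := Metric.isOpen_iff.1 ho x₀ hx₀
  let f : ContDiffBump x₀ := ⟨ε / 4, ε / 2, by positivity, by linarith⟩
  let φ : Space d → ℂ := fun x => (f x : ℂ)
  have hsub : tsupport φ ⊆ tsupport f :=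
    closure_mono fun x hx h => hx (by simp [φ, h])
  have hφ : IsTestFunction Ω φ := by
    refine ⟨Complex.ofRealCLM.contDiff.comp f.contDiff,
      f.hasCompactSupport.comp_left (g := fun r : ℝ => (r : ℂ)) Complex.ofReal_zero, ?_⟩
    refine hsub.trans ?_
    rw [f.tsupport_eq]
    exact (Metric.closedBall_subset_ball (show ε / 2 < ε by linarith)).trans hball
  have hD : Continuous (fderiv ℝ φ) := hφ.smooth.continuous_fderiv (by simp)
  have h1 : MemLp φ 2 (volume.restrict Ω) :=
    (hφ.smooth.continuous.memLp_of_hasCompactSupport hφ.compact).restrict Ω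
  have h2 : MemLp (classicalGrad φ) 2 (volume.restrict Ω) := by
    refine MemLp.restrict Ω (Continuous.memLp_of_hasCompactSupport
      ((PiLp.continuous_toLp 2 _).comp (continuous_pi fun j => hD.clm_apply continuous_const)) ?_)
    exact (hφ.compact.fderiv ℝ).comp_left
      (g := fun L : Space d →L[ℝ] ℂ => WithLp.toLp 2 fun j => L (EuclideanSpace.single j 1))
      (by ext; simp)
  let p : L2Pair Ω := WithLp.toLp 2 (h1.toLp φ, h2.toLp (classicalGrad φ))
  have hp : p ∈ testPairs Ω := ⟨φ, hφ, h1.coeFn_toLp, h2.coeFn_toLp⟩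
  have hp0 : ‖p.fst‖ ≠ 0 := by
    intro h
    have h0 : h1.toLp φ = 0 := norm_eq_zero.1 h
    have hae : φ =ᵐ[volume.restrict Ω] fun _ => 0 :=
      h1.coeFn_toLp.symm.trans (h0 ▸ Lp.coeFn_zero _ _ _)
    have := Measure.eqOn_open_of_ae_eq hae ho hφ.smooth.continuous.continuousOn
      continuousOn_const hx₀
    have hone : f x₀ = 1 := f.one_of_mem_closedBall (Metric.mem_closedBall_self (by positivity))
    simp [φ, hone] at this
  refine ⟨((‖p.fst‖⁻¹ : ℝ) : ℂ) • p, (testPairs Ω).smul_mem _ hp, ?_⟩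
  rw [WithLp.smul_fst, norm_smul, Complex.norm_real, norm_inv, norm_norm, inv_mul_cancel₀ hp0]

theorem constraintSet_nonempty (hd : 2 ≤ d) (ho : IsOpen Ω) (hne : Ω.Nonempty)
    (hΩ : Bornology.IsBounded Ω) {V : Fin 2 → Space d → ℝ} (ω : Fin 2 → ℝ)
    (hV : ∀ i, MemLp (V i) ⊤ (volume.restrict Ω)) (K : Matrix (Fin 2) (Fin 2) ℝ) :
    (constraintSet hd Ω V ω K).Nonempty := by
  obtain ⟨p, hp, hp1⟩ := exists_mem_testPairs_norm_fst_eq_one ho hne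
  obtain ⟨φ, hφ, hae, -⟩ := id hp
  let u : H10 Ω := ⟨p, Submodule.le_topologicalClosure _ hp⟩
  have hu : fn u =ᵐ[volume.restrict Ω] φ := hae
  have hz : fn (0 : H10 Ω) =ᵐ[volume.restrict Ω] fun _ => 0 := Lp.coeFn_zero _ _ _
  refine ⟨![u, 0], ?_, (finiteEnergy_iff hΩ ho.measurableSet hV).2 ?_⟩
  · have h1 : ‖fn u‖ = 1 := hp1
    have h0 : ‖fn (0 : H10 Ω)‖ = 0 := norm_zero
    simp [l2Norm, h1, h0]
  · rw [Fin.forall_fin_two]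
    constructor
    · have hi : Integrable (fun x => K 0 0 * ‖φ x‖ ^ 2 * ‖φ x‖ ^ 2) := by
        refine Continuous.integrable_of_hasCompactSupport ?_ ?_
        · have := hφ.smooth.continuous
          fun_prop
        · exact hφ.compact.comp_left (g := fun z : ℂ => K 0 0 * ‖z‖ ^ 2 * ‖z‖ ^ 2) (by simp)
      refine hi.integrableOn.congr ?_
      filter_upwards [hu, hz] with x h1 h2
      simp [density, h1, h2]
    · refine (integrable_zero _ _ _).congr ?_
      filter_upwards [hz] with x h2
      simp [h2]

theorem energy_nonneg {hd : 2 ≤ d} {V : Fin 2 → Space d → ℝ} {ω : Fin 2 → ℝ} {β : ℝ}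
    {K : Matrix (Fin 2) (Fin 2) ℝ} (hΩ : Bornology.IsBounded Ω) (hm : MeasurableSet Ω)
    (hV : PotentialAssumption hd Ω V ω β) (hK : InteractionAssumption K) {Ψ : Fin 2 → H10 Ω}
    (hΨ : FiniteEnergy hd Ω V ω K Ψ) : 0 ≤ energy hd Ω V ω β K Ψ := by
  choose M hM using fun i => exists_multiplication_rotField hd hΩ hm (ω i)
  rw [energy_eq hΩ hm hV.1 hM hΨ]
  exact add_nonneg (Finset.sum_nonneg fun i _ => by positivity)
    (integral_nonneg_of_ae ((localDensity_nonneg hV hK).mono fun x hx => hx _))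

/-- Finite energy follows from integrability of the total local density, because each interaction
density is controlled by their sum. -/
theorem finiteEnergy_of_integrable_localDensity {hd : 2 ≤ d} {V : Fin 2 → Space d → ℝ}
    {ω : Fin 2 → ℝ} {β : ℝ} {K : Matrix (Fin 2) (Fin 2) ℝ} (hΩ : Bornology.IsBounded Ω)
    (hm : MeasurableSet Ω) (hV : ∀ i, MemLp (V i) ⊤ (volume.restrict Ω))
    (hK : InteractionAssumption K) {Ψ : Fin 2 → H10 Ω}
    (hΨ : IntegrableOn (fun x => localDensity hd V ω β K x fun i => fn (Ψ i) x) Ω) :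
    FiniteEnergy hd Ω V ω K Ψ := by
  refine (finiteEnergy_iff hΩ hm hV).2 fun i => ?_
  obtain ⟨C, hC⟩ := exists_abs_interaction_le hK
  have hfn : ∀ j, AEStronglyMeasurable (fun x => ‖fn (Ψ j) x‖ ^ 2) (volume.restrict Ω) :=
    fun j => (Lp.aestronglyMeasurable (fn (Ψ j))).norm.pow 2
  have hq := integrable_quadDensity (hd := hd) (ω := ω) (β := β) hΩ hm hV Ψ
  refine (((hΨ.sub hq).const_mul 2).const_mul C).mono'
    ?_ (ae_of_all _ fun x => ?_)
  · refine AEStronglyMeasurable.mul ?_ (hfn i)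
    unfold density
    exact Finset.aestronglyMeasurable_fun_sum _ fun j _ => (hfn j).const_mul _
  · refine (hC (fun j => ‖fn (Ψ j) x‖ ^ 2) (fun j => by positivity) i).trans (le_of_eq ?_)
    simp only [Pi.sub_apply, localDensity]
    ring

/-- Compactness of bounded-energy sequences: a limit along a subsequence keeps the mass, and its
energy does not exceed the limit of the energies. -/
theorem exists_energy_le_of_tendsto {hd : 2 ≤ d} {V : Fin 2 → Space d → ℝ} {ω : Fin 2 → ℝ} {β : ℝ}
    {K : Matrix (Fin 2) (Fin 2) ℝ} (hΩ : Bornology.IsBounded Ω) (hm : MeasurableSet Ω)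
    (hV : PotentialAssumption hd Ω V ω β) (hK : InteractionAssumption K)
    {Ψ : ℕ → Fin 2 → H10 Ω} (hΨ : ∀ n, Ψ n ∈ constraintSet hd Ω V ω K) {m : ℝ}
    (hlim : Tendsto (fun n => energy hd Ω V ω β K (Ψ n)) atTop (𝓝 m)) :
    ∃ Φ ∈ constraintSet hd Ω V ω K, energy hd Ω V ω β K Φ ≤ m := by
  have : IsFiniteMeasure (volume.restrict Ω) := ⟨by simpa using hΩ.measure_lt_top⟩
  choose M hM using fun i => exists_multiplication_rotField hd hΩ hm (ω i)
  obtain ⟨B, hB⟩ := hlim.bddAbove_range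
  have hE : ∀ n, energy hd Ω V ω β K (Ψ n) ≤ B := fun n => hB ⟨n, rfl⟩
  have hB0 : 0 ≤ B := (energy_nonneg hΩ hm hV hK (hΨ 0).2).trans (hE 0)
  have hmass : ∀ n, ∑ i, ‖fn (Ψ n i)‖ ^ 2 = 1 := fun n => Real.sqrt_eq_one.1 (hΨ n).1
  have hu : ∀ i n, ‖fn (Ψ n i)‖ ≤ 2 * B + 1 := by
    intro i n
    have := Finset.single_le_sum (f := fun i => ‖fn (Ψ n i)‖ ^ 2)
      (fun j _ => by positivity) (Finset.mem_univ i)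
    rw [hmass] at this
    nlinarith [norm_nonneg (fn (Ψ n i))]
  have hg : ∀ i n, ‖wgrad (Ψ n i) - M i (fn (Ψ n i))‖ ≤ 2 * B + 1 := by
    intro i n
    have h1 := Finset.single_le_sum (f := fun i => 1 / 2 * ‖wgrad (Ψ n i) - M i (fn (Ψ n i))‖ ^ 2)
      (fun j _ => by positivity) (Finset.mem_univ i)
    have h2 : 0 ≤ ∫ x in Ω, localDensity hd V ω β K x fun i => fn (Ψ n i) x :=
      integral_nonneg_of_ae ((localDensity_nonneg hV hK).mono fun x hx => hx _)
    have h3 := hE n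
    rw [energy_eq hΩ hm hV.1 hM (hΨ n).2] at h3
    nlinarith [sq_nonneg (‖wgrad (Ψ n i) - M i (fn (Ψ n i))‖ - 1)]
  obtain ⟨v₀, φ, a₀, hφ, hs₀, hae₀, hn₀, hle₀⟩ := exists_subseq_tendsto_fn (M 0) (hu 0) (hg 0)
  obtain ⟨v₁, χ, a₁, hχ, hs₁, hae₁, hn₁, hle₁⟩ := exists_subseq_tendsto_fn (M 1)
    (fun n => hu 1 (φ n)) (fun n => hg 1 (φ n))
  have hs : ∀ i, Tendsto (fun n => fn (Ψ (φ (χ n)) i)) atTop (𝓝 (fn (![v₀, v₁] i))) :=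
    Fin.forall_fin_two.2 ⟨hs₀.comp hχ.tendsto_atTop, hs₁⟩
  have hn : ∀ i, Tendsto (fun n => ‖wgrad (Ψ (φ (χ n)) i) - M i (fn (Ψ (φ (χ n)) i))‖) atTop
      (𝓝 (![a₀, a₁] i)) := Fin.forall_fin_two.2 ⟨hn₀.comp hχ.tendsto_atTop, hn₁⟩
  have hle : ∀ i, ‖wgrad (![v₀, v₁] i) - M i (fn (![v₀, v₁] i))‖ ≤ ![a₀, a₁] i :=
    Fin.forall_fin_two.2 ⟨hle₀, hle₁⟩
  have hae : ∀ᵐ x ∂(volume.restrict Ω), ∀ i,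
      Tendsto (fun n => fn (Ψ (φ (χ n)) i) x) atTop (𝓝 (fn (![v₀, v₁] i) x)) := by
    filter_upwards [hae₀, hae₁] with x h0 h1
    exact Fin.forall_fin_two.2 ⟨h0.comp hχ.tendsto_atTop, h1⟩
  generalize (![v₀, v₁] : Fin 2 → H10 Ω) = Φ at hs hle hae
  generalize ![a₀, a₁] = a at hn hle
  -- The energies and the norms of the magnetic gradients converge, hence so do the local energies.
  have hc : Tendsto
      (fun n => ∫ x in Ω, localDensity hd V ω β K x fun i => fn (Ψ (φ (χ n)) i) x) atTop
      (𝓝 (m - ∑ i, 1 / 2 * a i ^ 2)) := by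
    refine ((hlim.comp (hφ.comp hχ).tendsto_atTop).sub
      (tendsto_finsetSum _ fun i _ => ((hn i).pow 2).const_mul (1 / 2))).congr fun n => ?_
    simp only [Function.comp_apply]
    rw [energy_eq hΩ hm hV.1 hM (hΨ _).2, add_sub_cancel_left]
  obtain ⟨hint, hFatou⟩ := integrable_and_integral_le_of_tendsto_ae
    (fun n => integrable_localDensity (β := β) hΩ hm hV.1 (hΨ (φ (χ n))).2)
    (fun n => (localDensity_nonneg hV hK).mono fun x hx => hx _)
    (G := fun x => localDensity hd V ω β K x fun i => fn (Φ i) x)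
    (hae.mono fun x hx =>
      ((continuous_localDensity hd V ω β K x).tendsto _).comp (tendsto_pi_nhds.2 hx)) hc
  have hfin : FiniteEnergy hd Ω V ω K Φ :=
    finiteEnergy_of_integrable_localDensity hΩ hm hV.1 hK hint
  refine ⟨Φ, ⟨?_, hfin⟩, ?_⟩
  · refine Real.sqrt_eq_one.2 (tendsto_nhds_unique
      (tendsto_finsetSum _ fun i _ => (hs i).norm.pow 2) ?_)
    simp only [hmass]
    exact tendsto_const_nhds
  · rw [energy_eq hΩ hm hV.1 hM hfin]
    have : ∑ i, 1 / 2 * ‖wgrad (Φ i) - M i (fn (Φ i))‖ ^ 2 ≤ ∑ i, 1 / 2 * a i ^ 2 :=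
      Finset.sum_le_sum fun i _ => by
        gcongr
        exact hle i
    linarith

end TwoComponentBEC

end

theorem lemma2p1 {d : ℕ} (hd : 2 ≤ d) (Ω : Set (TwoComponentBEC.Space d))
    (hΩ_open : IsOpen Ω) (hΩ_nonempty : Ω.Nonempty) (hΩ_bounded : Bornology.IsBounded Ω)
    (V : Fin 2 → TwoComponentBEC.Space d → ℝ) (ω : Fin 2 → ℝ) (β : ℝ)
    (K : Matrix (Fin 2) (Fin 2) ℝ)
    (A1 : TwoComponentBEC.PotentialAssumption hd Ω V ω β)
    (A2 : TwoComponentBEC.InteractionAssumption K) :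
    ∃ Ψg ∈ TwoComponentBEC.constraintSet hd Ω V ω K,
      ∀ Φ ∈ TwoComponentBEC.constraintSet hd Ω V ω K,
        TwoComponentBEC.energy hd Ω V ω β K Ψg ≤ TwoComponentBEC.energy hd Ω V ω β K Φ := by
  have hm := hΩ_open.measurableSet
  let S : Set ℝ := TwoComponentBEC.energy hd Ω V ω β K ''
    TwoComponentBEC.constraintSet hd Ω V ω K
  have hS : S.Nonempty := (TwoComponentBEC.constraintSet_nonempty hd hΩ_open hΩ_nonempty
    hΩ_bounded ω A1.1 K).image _
  have hbdd : BddBelow S := ⟨0, by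
    rintro _ ⟨Ψ, hΨ, rfl⟩
    exact TwoComponentBEC.energy_nonneg hΩ_bounded hm A1 A2 hΨ.2⟩
  obtain ⟨e, -, he, heS⟩ := exists_seq_tendsto_sInf hS hbdd
  choose Ψ hΨ hΨe using heS
  obtain ⟨Φ, hΦ, hle⟩ := TwoComponentBEC.exists_energy_le_of_tendsto hΩ_bounded hm A1 A2 hΨ
    (by simpa only [hΨe] using he)
  exact ⟨Φ, hΦ, fun Θ hΘ => hle.trans (csInf_le hbdd ⟨Θ, hΘ, rfl⟩)⟩
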